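/- Let $m,n$ be natural numbers and let $\mathsf{x}$ be a random vector in $\mathbb{R}^m$ of arbitrary distribution. For a non-empty bounded set $V\subseteq\mathbb{R}^m$ let $N_V(\rho)$ be the least number of open Euclidean balls of radius $\rho$ with centers in $\mathbb{R}^m$ needed to cover $V$, and let $$\underline{\dim}_{\mathrm B}(V)=\liminf_{\rho\to 0^+}\frac{\log N_V(\rho)}{\log(1/\rho)}$$ be its lower Minkowski dimension. For a non-empty set $U\subseteq\mathbb{R}^m$ let $$\underline{\dim}_{\mathrm{MB}}(U)=\inf\Big\{\sup_{i\in I}\underline{\dim}_{\mathrm B}(V_i) : U\subseteq\bigcup_{i\in I}V_i\Big\}$$ be its lower modified Minkowski dimension, where the infimum is over all countable covers $(V_i)_{i\in I}$ of $U$ by non-empty bounded Borel sets. Suppose that $$n>\inf\big\{\underline{\dim}_{\mathrm{MB}}(U) : U\subseteq\mathbb{R}^m,\ \mathbb{P}[\mathsf{x}\in U]=1\big\}.$$ Then, for Lebesgue almost all matrices $A\in\mathbb{R}^{n\times m}$, there exists a Borel measurable map $g_A\colon\mathbb{R}^n\to\mathbb{R}^m$ such that $\mathbb{P}[g_A(A\mathsf{x})\neq\mathsf{x}]=0$.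 -/

import Mathlib

open MeasureTheory Filter Topology Matrix

noncomputable section

/-- The covering number `N_U(ρ)` of a bounded set `U ⊆ ℝ^m`: the least number `k` of open Euclidean
balls of radius `ρ`, with arbitrary centers in `ℝ^m`, whose union contains `U`. -/
def coverNum {m : ℕ} (U : Set (EuclideanSpace ℝ (Fin m))) (ρ : ℝ) : ℕ :=
  sInf {k : ℕ | ∃ u : Fin k → EuclideanSpace ℝ (Fin m), U ⊆ ⋃ i, Metric.ball (u i) ρ}

/-- The lower Minkowski dimension of a non-empty bounded set `U ⊆ ℝ^m`, as an extended real: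
the limit inferior of `log N_U(ρ) / log (1/ρ)` as `ρ` tends to `0` from above. -/
def lowerMinkowskiDim {m : ℕ} (U : Set (EuclideanSpace ℝ (Fin m))) : EReal :=
  liminf (fun ρ : ℝ => ((Real.log (coverNum U ρ) / Real.log (1 / ρ) : ℝ) : EReal)) (𝓝[>] 0)

/-- The lower modified Minkowski dimension of a non-empty set `U ⊆ ℝ^m`: the infimum, over all
countable covers of `U` by non-empty bounded Borel sets, of the supremum of the lower Minkowski
dimensions of the covering sets. A non-empty countable family is enumerated by `ℕ`, repetitions
being allowed, so that finite covers are included. -/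
def lowerModifiedMinkowskiDim {m : ℕ} (U : Set (EuclideanSpace ℝ (Fin m))) : EReal :=
  sInf {d : EReal | ∃ V : ℕ → Set (EuclideanSpace ℝ (Fin m)),
    (∀ i, (V i).Nonempty ∧ Bornology.IsBounded (V i) ∧ MeasurableSet (V i)) ∧
    U ⊆ ⋃ i, V i ∧ d = ⨆ i, lowerMinkowskiDim (V i)}

end

/-! Fix `x` and a bounded `V` of lower Minkowski dimension below `s < n`. If `A` has bounded entries
and sends some `y ∈ V` with `|y j - x j| ≥ δ` to `A x`, then the center `u` of a `ρ`-ball around `y`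
satisfies `|A (u - x)| = O(ρ)` in each row. Each of the `n` rows thus lies in a slab of volume
`O(ρ)`, so one ball accounts for matrices of volume `O(ρ ^ n)`. For arbitrarily small `ρ`, at most
`ρ ^ (-s)` balls suffice, and `ρ ^ (n - s) → 0`: collisions with `x` are null
(`volume_bounded_collision_eq_zero`). Fubini turns "every `x`, almost every `A`" into "almost every
`A`, almost every `x`" (`ae_exists_measurable_decoder`). Almost every `A` is then injective on a
Borel set of full measure, and Lusin–Souslin gives a Borel inverse. -/

theorem det_one_updateRow {m : ℕ} (j : Fin m) (v : Fin m → ℝ) :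
    ((1 : Matrix (Fin m) (Fin m) ℝ).updateRow j v).det = v j := by
  have h := Matrix.det_updateRow_sum (1 : Matrix (Fin m) (Fin m) ℝ) j v
  have hv : ∑ k, v k • (1 : Matrix (Fin m) (Fin m) ℝ) k = v := by
    ext l
    simp [Finset.sum_apply, Matrix.one_apply]
  rw [hv] at h
  simpa using h

/-- The part of the slab `|⟨a, v⟩| ≤ ε` inside the cube of side `2 R` has volume `O(ε / |v j|)`. -/
theorem volume_slab_le {m : ℕ} (j : Fin m) (v : Fin m → ℝ) {R ε c : ℝ} (hR : 0 ≤ R) (hε : 0 ≤ ε)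
    (hc : 0 < c) (hv : c ≤ |v j|) :
    volume {a : Fin m → ℝ | (∀ l, |a l| ≤ R) ∧ |∑ l, a l * v l| ≤ ε} ≤
      ENNReal.ofReal (2 * (2 * R) ^ (m - 1) / c * ε) := by
  -- `f` replaces coordinate `j` of `a` by `⟨a, v⟩`, so it carries the truncated slab into a box and
  -- has determinant `v j`.
  set f : (Fin m → ℝ) →ₗ[ℝ] (Fin m → ℝ) :=
    Matrix.toLin' ((1 : Matrix (Fin m) (Fin m) ℝ).updateRow j v) with hf
  have hdet : LinearMap.det f = v j := by rw [hf, LinearMap.det_toLin', det_one_updateRow]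
  have hvj : 0 < |v j| := hc.trans_le hv
  have hdet0 : LinearMap.det f ≠ 0 := by rw [hdet]; exact abs_pos.1 hvj
  set s : Fin m → ℝ := fun i => if i = j then ε else R with hs
  have hsub : {a : Fin m → ℝ | (∀ l, |a l| ≤ R) ∧ |∑ l, a l * v l| ≤ ε} ⊆
      f ⁻¹' Set.pi Set.univ (fun i => Set.Icc (-s i) (s i)) := by
    rintro a ⟨ha, hav⟩ i -
    rw [Set.mem_Icc, ← abs_le, hf, Matrix.toLin'_apply, Matrix.mulVec, dotProduct]
    by_cases hij : i = j
    · subst hij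
      simpa [hs, mul_comm] using hav
    · simpa [hs, hij, Matrix.updateRow_ne, Matrix.one_apply] using ha i
  refine (measure_mono hsub).trans ?_
  rw [Measure.addHaar_preimage_linearMap _ hdet0, hdet, volume_pi_pi]
  simp only [Real.volume_Icc]
  have hs0 : ∀ i, 0 ≤ s i := fun i => by simp only [hs]; split_ifs <;> assumption
  rw [← ENNReal.ofReal_prod_of_nonneg (fun i _ => by linarith [hs0 i]),
    ← ENNReal.ofReal_mul (abs_nonneg _)]
  apply ENNReal.ofReal_le_ofReal
  have hprod : ∏ i, (s i - -s i) = 2 * ε * (2 * R) ^ (m - 1) := by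
    rw [← Finset.mul_prod_erase _ _ (Finset.mem_univ j),
      Finset.prod_congr rfl (g := fun _ => 2 * R)]
    · simp only [hs, if_true, Finset.prod_const, Finset.card_erase_of_mem (Finset.mem_univ j),
        Finset.card_univ, Fintype.card_fin]
      ring
    · intro i hi
      simp [hs, Finset.ne_of_mem_erase hi]; ring
  rw [hprod, abs_inv]
  calc |v j|⁻¹ * (2 * ε * (2 * R) ^ (m - 1)) ≤ c⁻¹ * (2 * ε * (2 * R) ^ (m - 1)) := by
        gcongr
    _ = _ := by ring

theorem exists_cover_of_isBounded {m : ℕ} {V : Set (EuclideanSpace ℝ (Fin m))}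
    (hV : Bornology.IsBounded V) {ρ : ℝ} (hρ : 0 < ρ) :
    ∃ u : Fin (coverNum V ρ) → EuclideanSpace ℝ (Fin m), V ⊆ ⋃ i, Metric.ball (u i) ρ := by
  refine Nat.sInf_mem (s := {k : ℕ | ∃ u : Fin k → EuclideanSpace ℝ (Fin m),
    V ⊆ ⋃ i, Metric.ball (u i) ρ}) ?_
  obtain ⟨t, -, ht, hVt⟩ := exists_finite_cover_balls_of_isCompact_closure
    hV.isCompact_closure hρ
  have := ht.fintype
  refine ⟨Fintype.card t, fun i => ((Fintype.equivFin t).symm i : _), fun x hx => ?_⟩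
  obtain ⟨y, hy, hxy⟩ := Set.mem_iUnion₂.1 (hVt hx)
  exact Set.mem_iUnion.2 ⟨Fintype.equivFin t ⟨y, hy⟩, by simpa using hxy⟩

theorem frequently_coverNum_le_rpow {m : ℕ} {V : Set (EuclideanSpace ℝ (Fin m))} {s : ℝ}
    (hs : lowerMinkowskiDim V < (s : EReal)) :
    ∃ᶠ ρ in 𝓝[>] (0 : ℝ), (coverNum V ρ : ℝ) ≤ ρ ^ (-s) := by
  have h := frequently_lt_of_liminf_lt (by isBoundedDefault) hs
  have h1 : ∀ᶠ ρ in 𝓝[>] (0 : ℝ), ρ ∈ Set.Ioo (0 : ℝ) 1 := Ioo_mem_nhdsGT one_pos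
  refine (h.and_eventually h1).mono ?_
  rintro ρ ⟨hρ, h0, h1⟩
  -- Comparing logarithms requires a positive covering number.
  rcases (coverNum V ρ).eq_zero_or_pos with hN | hN
  · rw [hN]; simpa using Real.rpow_nonneg h0.le _
  have hlog : 0 < Real.log (1 / ρ) := Real.log_pos (by rw [lt_div_iff₀ h0]; linarith)
  rw [EReal.coe_lt_coe_iff, div_lt_iff₀ hlog] at hρ
  rw [← Real.log_le_log_iff (by exact_mod_cast hN) (Real.rpow_pos_of_pos h0 _),
    Real.log_rpow h0]
  rw [one_div, Real.log_inv] at hρ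
  linarith

/-- A fixed point and a point of `V` that is `δ` away in the coordinate `j` have the same image only
under a null set of matrices with entries bounded by `R`. -/
theorem volume_bounded_collision_eq_zero {m n : ℕ} {V : Set (EuclideanSpace ℝ (Fin m))}
    (hV : Bornology.IsBounded V) (hdim : lowerMinkowskiDim V < (n : EReal))
    (x : EuclideanSpace ℝ (Fin m)) (j : Fin m) {δ R : ℝ} (hδ : 0 < δ) (hR : 0 ≤ R) :
    volume {A : Fin n → Fin m → ℝ | (∀ i l, |A i l| ≤ R) ∧
      ∃ y ∈ V, δ ≤ |y j - x j| ∧ ∀ i, ∑ l, A i l * (y l - x l) = 0} = 0 := by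
  obtain ⟨s, hVs, hsn⟩ := EReal.lt_iff_exists_real_btwn.1 hdim
  have hsn : s < n := by exact_mod_cast hsn
  -- The slab bound with `c = δ / 2` and `ε = m * R * ρ` is `D * ρ`.
  set D : ℝ := 2 * (2 * R) ^ (m - 1) / (δ / 2) * (m * R) with hD
  have hD0 : 0 ≤ D := by positivity
  set S := {A : Fin n → Fin m → ℝ | (∀ i l, |A i l| ≤ R) ∧
      ∃ y ∈ V, δ ≤ |y j - x j| ∧ ∀ i, ∑ l, A i l * (y l - x l) = 0}
  have key : ∀ ρ : ℝ, 0 < ρ → ρ < δ / 2 →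
      volume S ≤ ENNReal.ofReal (coverNum V ρ * (D * ρ) ^ n) := by
    intro ρ hρ hρδ
    obtain ⟨u, hu⟩ := exists_cover_of_isBounded hV hρ
    set T : Fin (coverNum V ρ) → Set (Fin n → Fin m → ℝ) := fun k =>
      {A | δ / 2 ≤ |u k j - x j| ∧ ∀ i, (∀ l, |A i l| ≤ R) ∧
        |∑ l, A i l * (u k l - x l)| ≤ m * R * ρ} with hT
    have hsub : S ⊆ ⋃ k, T k := by
      rintro A ⟨hA, y, hy, hyx, hAy⟩
      obtain ⟨k, hk⟩ := Set.mem_iUnion.1 (hu hy)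
      have hcoord : ∀ l, |u k l - y l| ≤ ρ := fun l => by
        have := PiLp.norm_apply_le (u k - y) l
        rw [← dist_eq_norm, dist_comm] at this
        simpa using this.trans (Metric.mem_ball.1 hk).le
      refine Set.mem_iUnion.2 ⟨k, ?_, fun i => ⟨hA i, ?_⟩⟩
      · have h1 := hcoord j
        have h2 := abs_sub_le (y j) (u k j) (x j)
        rw [abs_sub_comm (y j) (u k j)] at h2
        linarith
      · have h1 : ∑ l, A i l * (u k l - x l) = ∑ l, A i l * (u k l - y l) := by
          rw [← sub_eq_zero, ← hAy i, ← Finset.sum_sub_distrib]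
          exact Finset.sum_congr rfl fun l _ => by ring
        rw [h1]
        calc |∑ l, A i l * (u k l - y l)| ≤ ∑ l, |A i l * (u k l - y l)| :=
              Finset.abs_sum_le_sum_abs _ _
          _ ≤ ∑ _l : Fin m, R * ρ := Finset.sum_le_sum fun l _ => by
              rw [abs_mul]
              exact mul_le_mul (hA i l) (hcoord l) (abs_nonneg _) hR
          _ = m * R * ρ := by simp [mul_assoc]
    have hTk : ∀ k, volume (T k) ≤ ENNReal.ofReal ((D * ρ) ^ n) := by
      intro k
      by_cases hk : δ / 2 ≤ |u k j - x j|
      · have : T k ⊆ Set.pi Set.univ fun _ : Fin n => {a : Fin m → ℝ | (∀ l, |a l| ≤ R) ∧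
            |∑ l, a l * (u k l - x l)| ≤ m * R * ρ} := fun A hA i _ => hA.2 i
        refine (measure_mono this).trans ?_
        rw [volume_pi_pi, Finset.prod_const, Finset.card_univ, Fintype.card_fin,
          ENNReal.ofReal_pow (by positivity)]
        gcongr
        refine (volume_slab_le j (fun l => u k l - x l) hR (by positivity)
          (half_pos hδ) hk).trans_eq ?_
        rw [hD]; ring_nf
      · have : T k = ∅ := by
          ext A; simp [hT, hk]
        simp [this]
    calc volume S ≤ ∑ k, volume (T k) := (measure_mono hsub).trans (measure_iUnion_fintype_le _ _)
      _ ≤ ∑ _k : Fin (coverNum V ρ), ENNReal.ofReal ((D * ρ) ^ n) :=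
          Finset.sum_le_sum fun k _ => hTk k
      _ = ENNReal.ofReal (coverNum V ρ * (D * ρ) ^ n) := by
          rw [ENNReal.ofReal_mul (by positivity)]
          simp
  have hlim : Tendsto (fun ρ : ℝ => ENNReal.ofReal (D ^ n * ρ ^ ((n : ℝ) - s))) (𝓝[>] 0)
      (𝓝 0) := by
    rw [← ENNReal.ofReal_zero]
    refine ENNReal.tendsto_ofReal ?_
    have h1 : Tendsto (fun ρ : ℝ => ρ ^ ((n : ℝ) - s)) (𝓝[>] 0) (𝓝 0) := by
      have := (Real.continuousAt_rpow_const 0 ((n : ℝ) - s) (Or.inr (by linarith))).tendsto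
      rw [Real.zero_rpow (by linarith)] at this
      exact this.mono_left nhdsWithin_le_nhds
    simpa using h1.const_mul (D ^ n)
  -- The left side does not depend on `ρ`, so a bound along some `ρ → 0` suffices; this is why the
  -- lower dimension is enough.
  refine le_antisymm (ge_of_tendsto_of_frequently hlim ?_) bot_le
  have hsmall : ∀ᶠ ρ in 𝓝[>] (0 : ℝ), ρ ∈ Set.Ioo (0 : ℝ) (δ / 2) := Ioo_mem_nhdsGT (half_pos hδ)
  refine ((frequently_coverNum_le_rpow hVs).and_eventually hsmall).mono ?_
  rintro ρ ⟨hN, h0, hρδ⟩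
  refine (key ρ h0 hρδ).trans (ENNReal.ofReal_le_ofReal ?_)
  calc coverNum V ρ * (D * ρ) ^ n ≤ ρ ^ (-s) * (D * ρ) ^ n := by gcongr
    _ = D ^ n * ρ ^ ((n : ℝ) - s) := by
        rw [sub_eq_add_neg, Real.rpow_add h0, Real.rpow_natCast]; ring

/-- The linear map of Euclidean spaces given by an array of coefficients. -/
abbrev euclideanMulVec {m n : ℕ} (A : Fin n → Fin m → ℝ) (x : EuclideanSpace ℝ (Fin m)) :
    EuclideanSpace ℝ (Fin n) :=
  WithLp.toLp 2 (Matrix.of A *ᵥ x.ofLp)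

theorem continuous_euclideanMulVec {m n : ℕ} :
    Continuous fun p : (Fin n → Fin m → ℝ) × EuclideanSpace ℝ (Fin m) =>
      euclideanMulVec p.1 p.2 := by
  unfold euclideanMulVec Matrix.mulVec dotProduct
  simp only [Matrix.of_apply]
  fun_prop

/-- The null sets are exhausted over the coordinate `j`, the gap `1 / (k + 1)` and the entry bound
`r`. -/
theorem ae_forall_euclideanMulVec_ne {m n : ℕ} {V : Set (EuclideanSpace ℝ (Fin m))}
    (hV : Bornology.IsBounded V) (hdim : lowerMinkowskiDim V < (n : EReal))
    (x : EuclideanSpace ℝ (Fin m)) :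
    ∀ᵐ A : Fin n → Fin m → ℝ, ∀ y ∈ V, y ≠ x → euclideanMulVec A y ≠ euclideanMulVec A x := by
  have h : ∀ᵐ A : Fin n → Fin m → ℝ, ∀ (j : Fin m) (k r : ℕ), ¬ ((∀ i l, |A i l| ≤ r) ∧
      ∃ y ∈ V, 1 / ((k : ℝ) + 1) ≤ |y j - x j| ∧ ∀ i, ∑ l, A i l * (y l - x l) = 0) := by
    simp only [ae_all_iff]
    intro j k r
    rw [ae_iff]
    simpa only [not_not] using volume_bounded_collision_eq_zero hV hdim x j
      (δ := 1 / ((k : ℝ) + 1)) (by positivity) (R := (r : ℝ)) (by positivity)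
  filter_upwards [h] with A hA y hy hyx heq
  obtain ⟨j, hj⟩ : ∃ j, y j ≠ x j := by
    by_contra! hall
    exact hyx (by ext j; exact hall j)
  obtain ⟨k, hk⟩ := exists_nat_one_div_lt (abs_pos.2 (sub_ne_zero.2 hj))
  obtain ⟨r, hr⟩ := exists_nat_ge (‖A‖)
  refine hA j k r ⟨fun i l => ?_, y, hy, hk.le, fun i => ?_⟩
  · exact ((norm_le_pi_norm (A i) l).trans (norm_le_pi_norm A i)).trans hr
  · have := congrArg (fun z => z i) heq
    simp only [Matrix.mulVec, dotProduct, Matrix.of_apply] at this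
    simp only [mul_sub, Finset.sum_sub_distrib]
    linarith

/-- Measurability for Fubini: with `y ≠ x` exhausted by `dist y x ≥ 1 / (k + 1)`, each piece
projects along a compact factor, hence to a closed set. -/
theorem measurableSet_collision {m n : ℕ} {ι : Type*} [Countable ι]
    {K : ι → Set (EuclideanSpace ℝ (Fin m))} (hK : ∀ i, IsCompact (K i)) :
    MeasurableSet {p : (Fin n → Fin m → ℝ) × EuclideanSpace ℝ (Fin m) |
      ∃ i, ∃ y ∈ K i, y ≠ p.2 ∧ euclideanMulVec p.1 y = euclideanMulVec p.1 p.2} := by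
  have heq : {p : (Fin n → Fin m → ℝ) × EuclideanSpace ℝ (Fin m) |
      ∃ i, ∃ y ∈ K i, y ≠ p.2 ∧ euclideanMulVec p.1 y = euclideanMulVec p.1 p.2} =
      ⋃ (i : ι) (k : ℕ), Prod.fst '' {q : ((Fin n → Fin m → ℝ) × EuclideanSpace ℝ (Fin m)) × K i |
        1 / ((k : ℝ) + 1) ≤ dist (q.2 : EuclideanSpace ℝ (Fin m)) q.1.2 ∧
          euclideanMulVec q.1.1 (q.2 : EuclideanSpace ℝ (Fin m)) =
            euclideanMulVec q.1.1 q.1.2} := by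
    ext p
    simp only [Set.mem_ofPred_eq, Set.mem_iUnion, Set.mem_image]
    constructor
    · rintro ⟨i, y, hy, hne, he⟩
      obtain ⟨k, hk⟩ := exists_nat_one_div_lt (dist_pos.2 hne)
      exact ⟨i, k, (p, ⟨y, hy⟩), ⟨hk.le, he⟩, rfl⟩
    · rintro ⟨i, k, ⟨p', y⟩, ⟨hd, he⟩, rfl⟩
      exact ⟨i, y, y.2, dist_pos.1 (lt_of_lt_of_le (by positivity) hd), he⟩
  rw [heq]
  refine MeasurableSet.iUnion fun i => MeasurableSet.iUnion fun k => IsClosed.measurableSet ?_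
  have := isCompact_iff_compactSpace.1 (hK i)
  refine isClosedMap_fst_of_compactSpace _ ?_
  rw [Set.ofPred_and]
  refine IsClosed.inter (isClosed_le ?_ ?_) (isClosed_eq ?_ ?_)
  · fun_prop
  · fun_prop
  · exact continuous_euclideanMulVec.comp (by fun_prop :
      Continuous fun q : ((Fin n → Fin m → ℝ) × EuclideanSpace ℝ (Fin m)) × K i =>
        (q.1.1, (q.2 : EuclideanSpace ℝ (Fin m))))
  · exact continuous_euclideanMulVec.comp continuous_fst

/-- Lusin–Souslin: a continuous injection on a Borel set is a measurable embedding. -/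
theorem exists_measurable_leftInvOn {m n : ℕ} (A : Fin n → Fin m → ℝ)
    {G : Set (EuclideanSpace ℝ (Fin m))} (hG : MeasurableSet G)
    (hinj : Set.InjOn (euclideanMulVec A) G) :
    ∃ g : EuclideanSpace ℝ (Fin n) → EuclideanSpace ℝ (Fin m),
      Measurable g ∧ Set.LeftInvOn g (euclideanMulVec A) G := by
  have hc : Continuous (euclideanMulVec A) :=
    continuous_euclideanMulVec.comp (Continuous.prodMk_right A)
  obtain ⟨g, hg, hgA⟩ := (hc.continuousOn.measurableEmbedding hG hinj).exists_measurable_extend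
    (measurable_subtype_coe) (fun _ => ⟨0⟩)
  exact ⟨g, hg, fun x hx => congrFun hgA ⟨x, hx⟩⟩

theorem ae_exists_measurable_decoder {m n : ℕ} {ι : Type*} [Countable ι]
    (μ : Measure (EuclideanSpace ℝ (Fin m))) [SFinite μ]
    {K : ι → Set (EuclideanSpace ℝ (Fin m))} (hK : ∀ i, IsCompact (K i))
    (hdim : ∀ i, ∃ V, K i ⊆ V ∧ Bornology.IsBounded V ∧ lowerMinkowskiDim V < (n : EReal))
    (hμ : ∀ᵐ x ∂μ, x ∈ ⋃ i, K i) :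
    ∀ᵐ A : Fin n → Fin m → ℝ, ∃ g : EuclideanSpace ℝ (Fin n) → EuclideanSpace ℝ (Fin m),
      Measurable g ∧ ∀ᵐ x ∂μ, g (euclideanMulVec A x) = x := by
  have hB := measurableSet_collision (n := n) hK
  have hae : ∀ᵐ x ∂μ, ∀ᵐ A : Fin n → Fin m → ℝ,
      ¬ ∃ i, ∃ y ∈ K i, y ≠ x ∧ euclideanMulVec A y = euclideanMulVec A x := by
    refine ae_of_all _ fun x => ?_
    have h : ∀ᵐ A : Fin n → Fin m → ℝ, ∀ i, ∀ y ∈ K i, y ≠ x →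
        euclideanMulVec A y ≠ euclideanMulVec A x := by
      rw [ae_all_iff]
      intro i
      obtain ⟨V, hKV, hV, hVn⟩ := hdim i
      filter_upwards [ae_forall_euclideanMulVec_ne hV hVn x] with A hA y hy
      exact hA y (hKV hy)
    filter_upwards [h] with A hA
    rintro ⟨i, y, hy, hne, he⟩
    exact hA i y hy hne he
  rw [← Measure.ae_ae_comm hB.compl] at hae
  filter_upwards [hae] with A hA
  have hGm : MeasurableSet ((⋃ i, K i) ∩ {x | ¬ ∃ i, ∃ y ∈ K i, y ≠ x ∧
      euclideanMulVec A y = euclideanMulVec A x}) :=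
    (MeasurableSet.iUnion fun i => (hK i).measurableSet).inter
      (measurable_prodMk_left hB.compl)
  obtain ⟨g, hg, hgA⟩ := exists_measurable_leftInvOn A hGm (by
    rintro x ⟨hx, -⟩ y ⟨-, hy⟩ hxy
    obtain ⟨i, hi⟩ := Set.mem_iUnion.1 hx
    by_contra hne
    exact hy ⟨i, x, hi, hne, hxy⟩)
  refine ⟨g, hg, ?_⟩
  filter_upwards [hA, hμ] with x hx hxK
  exact hgA ⟨hxK, hx⟩

/-- Inner regularity; it reduces Borel covers to the compact ones that measurability of the
collision set needs. -/
theorem exists_isCompact_seq_ae_mem {m : ℕ} (μ : Measure (EuclideanSpace ℝ (Fin m)))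
    [IsFiniteMeasure μ] {V : Set (EuclideanSpace ℝ (Fin m))} (hV : MeasurableSet V) :
    ∃ K : ℕ → Set (EuclideanSpace ℝ (Fin m)), (∀ k, IsCompact (K k) ∧ K k ⊆ V) ∧
      ∀ᵐ x ∂μ, x ∈ V → x ∈ ⋃ k, K k := by
  have h : ∀ k : ℕ, ∃ K ⊆ V, IsCompact K ∧ μ (V \ K) < ((k : ENNReal) + 1)⁻¹ := fun k =>
    hV.exists_isCompact_sdiff_lt (measure_ne_top _ _) (by simp)
  choose K hKV hK hμK using h
  refine ⟨K, fun k => ⟨hK k, hKV k⟩, ?_⟩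
  have hlim : Tendsto (fun k : ℕ => ((k : ENNReal) + 1)⁻¹) atTop (𝓝 0) := by
    simpa using (tendsto_add_atTop_iff_nat 1).2 ENNReal.tendsto_inv_nat_nhds_zero
  have h0 : μ (V \ ⋃ k, K k) = 0 := by
    refine le_antisymm (ge_of_tendsto' hlim fun k => ?_) bot_le
    exact (measure_mono (Set.sdiff_subset_sdiff_right (Set.subset_iUnion K k))).trans (hμK k).le
  rw [ae_iff]
  convert! h0 using 2
  ext x
  simp

theorem theorem1 {Ω : Type*} [MeasurableSpace Ω] (P : Measure Ω) [IsProbabilityMeasure P]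
    (m n : ℕ) (X : Ω → EuclideanSpace ℝ (Fin m)) (hX : Measurable X)
    (hn : sInf {d : EReal | ∃ U : Set (EuclideanSpace ℝ (Fin m)),
        P {ω | X ω ∈ U} = 1 ∧ d = lowerModifiedMinkowskiDim U} < (n : EReal)) :
    ∀ᵐ A : Fin n → Fin m → ℝ ∂(volume : Measure (Fin n → Fin m → ℝ)),
      ∃ g : EuclideanSpace ℝ (Fin n) → EuclideanSpace ℝ (Fin m), Measurable g ∧
        P {ω | g (WithLp.toLp 2 (Matrix.of A *ᵥ (X ω).ofLp)) ≠ X ω} = 0 := by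
  obtain ⟨_, ⟨U, hU, rfl⟩, hUn⟩ := sInf_lt_iff.1 hn
  obtain ⟨_, ⟨V, hV, hUV, rfl⟩, hVn⟩ := sInf_lt_iff.1 hUn
  have hVdim : ∀ i, lowerMinkowskiDim (V i) < (n : EReal) := fun i =>
    (le_iSup (fun i => lowerMinkowskiDim (V i)) i).trans_lt hVn
  have := Measure.isProbabilityMeasure_map (μ := P) hX.aemeasurable
  have hVm : MeasurableSet (⋃ i, V i) := MeasurableSet.iUnion fun i => (hV i).2.2
  have hVμ : ∀ᵐ x ∂P.map X, x ∈ ⋃ i, V i := by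
    refine (ae_map_iff hX.aemeasurable hVm).2 ((prob_compl_eq_zero_iff (hX hVm)).2 ?_)
    -- `U` need not be measurable, so its full measure is transferred to the Borel union containing
    -- it.
    refine le_antisymm prob_le_one ?_
    rw [← hU]
    exact measure_mono fun ω hω => hUV hω
  choose K hK hKμ using fun i => exists_isCompact_seq_ae_mem (P.map X) (hV i).2.2
  have hdec := ae_exists_measurable_decoder (n := n) (P.map X)
    (K := fun p : ℕ × ℕ => K p.1 p.2) (fun p => (hK p.1 p.2).1)
    (fun p => ⟨V p.1, (hK p.1 p.2).2, (hV p.1).2.1, hVdim p.1⟩) (by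
      filter_upwards [hVμ, ae_all_iff.2 hKμ] with x hx hxK
      obtain ⟨i, hi⟩ := Set.mem_iUnion.1 hx
      obtain ⟨k, hk⟩ := Set.mem_iUnion.1 (hxK i hi)
      exact Set.mem_iUnion.2 ⟨(i, k), hk⟩)
  filter_upwards [hdec] with A ⟨g, hg, hgA⟩
  exact ⟨g, hg, ae_iff.1 (ae_of_ae_map hX.aemeasurable hgA)⟩
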